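/- Definitions. For $n\times n$ real matrices $A,B$, an $n\times n$ real matrix $M$ is called an LDR matrix for $(A,B)$ if $M-AMB=gh^{T}$ for some $g,h\in\mathbb R^n$. A unit is a binary step unit, with activation $t\mapsto \mathbf 1\{t\ge 0\}$, or a rectifier linear unit (ReLU), with activation $t\mapsto\max(0,t)$. An LDR neural network $G_{A,B}$ has an input layer of $n$ neurons, consecutive hidden layers of $k_1n, k_2n,\dots,k_Ln$ units (with $k_0=1$ for the input layer), and one linear output neuron. Hidden layer $\ell$ maps the output $z$ of the preceding layer to $\sigma(W^{T}z+\theta)$, where $\theta$ is any real bias vector, $\sigma$ is applied coordinatewise with the activation of each unit, and $W$ is a $k_{\ell-1}n\times k_\ell n$ matrix that is partitioned into $n\times n$ submatrices, each of them an LDR matrix for $(A,B)$. The output neuron forms a linear combination $\sum_j\alpha_j z_j$ of the last layer. A scalar input $x$ is fed to the network as the zero-padded vector $(x,0,\dots,0)\in\mathbb R^n$, and $G_{A,B}(x)$ denotes the output. Theorem. Let $\log$ denote the logarithm to a fixed base $b$ with $1<b\le e$ (for instance the binary or the natural logarithm), and let $0<\epsilon_0<1$. There is a constant $C>0$, depending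 only on $b$ and $\epsilon_0$, such that the following holds for every $0<\epsilon\le\epsilon_0$. Put $n=\lceil\log\frac1\epsilon+1\rceil$. Let $f$ be a continuous function on $[0,1]$ that is $2n+1$ times differentiable in $(0,1)$ with $|f^{(k)}(x)|\le k!$ for all $x\in(0,1)$ and all $k\in\{1,\dots,2n+1\}$. Let $A,B\in\mathbb R^{n\times n}$ be nonsingular matrices, diagonalizable over $\mathbb C$, such that (i) $A^q=aI$ for some positive integer $q\le n$ and some real $a\ne0$, (ii) $I-aB^q$ is nonsingular, for the same $q$ and $a$, (iii) the $n$ complex eigenvalues of $B$, counted with multiplicity, have pairwise distinct absolute values. Then there is an LDR neural network $G_{A,B}$ with at most $C\log\frac1\epsilon$ hidden layers, at most $C\,n\log\frac1\epsilon$ binary step units and at most $C\,n\log^2\frac1\epsilon$ rectifier linear units (that is, with $O(\log\frac1\epsilon)$ layers, $O(n\log\frac1\epsilon)$ binary step units and $O(n\log^2\frac1\epsilon)$ ReLUs) such that $$\sup_{x\in[0,1]}|f(x)-G_{A,B}(x)|<\epsilon .$$ -/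

import Mathlib

open Matrix

namespace LDR

/-- A real square matrix is diagonalizable if it is similar, over the complex numbers, to a
diagonal matrix. -/
def IsDiagonalizable {n : ℕ} (M : Matrix (Fin n) (Fin n) ℝ) : Prop :=
  ∃ (P : Matrix (Fin n) (Fin n) ℂ) (d : Fin n → ℂ),
    IsUnit P.det ∧ M.map (algebraMap ℝ ℂ) = P * Matrix.diagonal d * P⁻¹

/-- The `n` complex eigenvalues of `M`, counted with multiplicity, have pairwise distinct
absolute values. -/
def EigenvaluesDistinctAbs {n : ℕ} (M : Matrix (Fin n) (Fin n) ℝ) : Prop :=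
  ((M.map (algebraMap ℝ ℂ)).charpoly.roots.map (fun z : ℂ => ‖z‖)).Nodup

/-- The conditions on a pair of displacement operators: `A` and `B` are nonsingular and
diagonalizable, `A ^ q = a I` for some positive `q ≤ n` and some `a ≠ 0` with `I - a B ^ q`
nonsingular, and the eigenvalues of `B` have distinct absolute values. -/
structure AdmissibleOperators {n : ℕ} (A B : Matrix (Fin n) (Fin n) ℝ) : Prop where
  isUnit_det_left : IsUnit A.det
  isUnit_det_right : IsUnit B.det
  diagonalizable_left : IsDiagonalizable A
  diagonalizable_right : IsDiagonalizable B
  potent : ∃ (q : ℕ) (a : ℝ), 0 < q ∧ q ≤ n ∧ a ≠ 0 ∧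
    A ^ q = a • (1 : Matrix (Fin n) (Fin n) ℝ) ∧
    IsUnit (1 - a • B ^ q : Matrix (Fin n) (Fin n) ℝ).det
  eigenvalues_right : EigenvaluesDistinctAbs B

/-- The Stein displacement `M - A M B`. -/
def steinDisplacement {n : ℕ} (A B M : Matrix (Fin n) (Fin n) ℝ) : Matrix (Fin n) (Fin n) ℝ :=
  M - A * M * B

/-- The matrices `M` whose Stein displacement with respect to `(A, B)` has the form `g hᵀ`. -/
def ldrMatrices {n : ℕ} (A B : Matrix (Fin n) (Fin n) ℝ) : Set (Matrix (Fin n) (Fin n) ℝ) :=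
  {M | ∃ g h : Fin n → ℝ, steinDisplacement A B M = Matrix.vecMulVec g h}

/-- The two types of units: binary step units and rectifier linear units. -/
inductive UnitKind
  | step
  | relu
  deriving DecidableEq

/-- The activation function of a unit. -/
noncomputable def UnitKind.act : UnitKind → ℝ → ℝ
  | .step, t => if 0 ≤ t then 1 else 0
  | .relu, t => max 0 t

/-- A fully connected layer from `k * n` units to `m * n` units, each set of units being split
into groups of `n`. The weight matrix consists of `n × n` submatrices, every one of which is an
LDR matrix for `(A, B)`; every unit of the layer has a bias and a type. -/
structure Layer {n : ℕ} (A B : Matrix (Fin n) (Fin n) ℝ) (k m : ℕ) where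
  weight : Matrix (Fin k × Fin n) (Fin m × Fin n) ℝ
  bias : Fin m × Fin n → ℝ
  kind : Fin m × Fin n → UnitKind
  weight_mem : ∀ (i : Fin k) (j : Fin m),
    weight.submatrix (fun r : Fin n => (i, r)) (fun s : Fin n => (j, s)) ∈ ldrMatrices A B

/-- The layer maps `z` to `σ (Wᵀ z + θ)`, with the activation of each unit. -/
noncomputable def Layer.eval {n : ℕ} {A B : Matrix (Fin n) (Fin n) ℝ} {k m : ℕ}
    (ℓ : Layer A B k m) (z : Fin k × Fin n → ℝ) : Fin m × Fin n → ℝ :=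
  fun u => (ℓ.kind u).act ((ℓ.weightᵀ *ᵥ z) u + ℓ.bias u)

/-- The number of units of type `t` in a layer. -/
def Layer.unitCount {n : ℕ} {A B : Matrix (Fin n) (Fin n) ℝ} {k m : ℕ}
    (ℓ : Layer A B k m) (t : UnitKind) : ℕ :=
  (Finset.univ.filter (fun u => ℓ.kind u = t)).card

/-- A finite sequence of consecutive layers, from `k * n` units to `m * n` units; each layer
receives the outputs of the preceding one only. -/
inductive Layers {n : ℕ} (A B : Matrix (Fin n) (Fin n) ℝ) : ℕ → ℕ → Type
  | nil (k : ℕ) : Layers A B k k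
  | snoc {k m p : ℕ} (init : Layers A B k m) (last : Layer A B m p) : Layers A B k p

namespace Layers

variable {n : ℕ} {A B : Matrix (Fin n) (Fin n) ℝ}

noncomputable def eval : {k m : ℕ} → Layers A B k m → (Fin k × Fin n → ℝ) → (Fin m × Fin n → ℝ)
  | _, _, .nil _, z => z
  | _, _, .snoc init last, z => last.eval (init.eval z)

/-- The number of layers. -/
def length : {k m : ℕ} → Layers A B k m → ℕ
  | _, _, .nil _ => 0
  | _, _, .snoc init _ => init.length + 1

/-- The total number of units of type `t`. -/
def unitCount : {k m : ℕ} → Layers A B k m → UnitKind → ℕ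
  | _, _, .nil _, _ => 0
  | _, _, .snoc init last, t => init.unitCount t + last.unitCount t

end Layers

/-- A (multi-layer) LDR neural network for `(A, B)`: `n` input neurons, hidden layers whose weight
matrices consist of LDR matrices for `(A, B)`, and one linear output neuron with coefficients
`α`. -/
structure Network {n : ℕ} (A B : Matrix (Fin n) (Fin n) ℝ) where
  groups : ℕ
  hidden : Layers A B 1 groups
  α : Fin groups × Fin n → ℝ

/-- The scalar input `x`, padded with zeros to a vector of length `n`. -/
def padInput {n : ℕ} (x : ℝ) : Fin 1 × Fin n → ℝ :=
  fun u => if (u.2 : ℕ) = 0 then x else 0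

/-- The function of one real variable computed by the network. -/
noncomputable def Network.eval {n : ℕ} {A B : Matrix (Fin n) (Fin n) ℝ} (G : Network A B)
    (x : ℝ) : ℝ :=
  ∑ u, G.α u * G.hidden.eval (padInput x) u

end LDR

/-!
A group of `n` units behaves like one unit of a network without structural restrictions. Since the
eigenvalues of `B` have distinct absolute values they are real, and as `B` is diagonalizable
some real left eigenvector `h` of `B` has a nonzero entry at position `0`
(`exists_left_eigenvector`). If `hᵀ B = c hᵀ`, every matrix `M = w hᵀ` satisfies
`M - A M B = (w - c A w) hᵀ`, hence is an LDR matrix, and its column `0` is an arbitrary vector.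
So the unit at position `0` of each group can be given any weights; it reads only the units at
position `0` of the preceding groups, and the other `n - 1` units of the group are never used
(`exists_layer`). This is where the factors `n` in the numbers of units come from.

It remains to approximate `f` by an ordinary network with `O(n)` layers, `O(n)` step units and
`O(n²)` rectifiers, because `n` is bounded by a constant times `log (1 / ε)`. With `N = 2 n + 1`:

* `N` layers, with one step unit each, extract the first `N` binary digits `d i` of `x`
  (`realizes_digits`). Let `y = ∑ d i 2 ^ -i` be the truncation, so that `|x - y| ≤ 2 ^ -N`.
* Multiplication by `y` of a number `p ∈ [0, 1]` costs `N` rectifiers, since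
  `y p = ∑ max 0 (2 (d i - 1) + 2 ^ -i p)`. So `N` further layers yield `1, y, …, y ^ (N - 1)`
  (`realizes_powerState`), and the output neuron forms any polynomial of degree less than `N` at `y`
  exactly (`exists_network_eval_binTrunc`).
* The Taylor polynomial of `f` at `1 / 2` of degree `2 n` has error at most `2 ^ -N`
  (`exists_polynomial_approx`), and `|f x - f y| ≤ |x - y|`.

The total error is at most `2 * 2 ^ -(2 n + 1) = 4 ^ -n`, which is less than `ε` because `b < 4`.
-/

namespace LDR

/-! ### Units with arbitrary weights from LDR matrices -/

lemma mem_roots_charpoly_of_vecMul {ι : Type*} [Fintype ι] [DecidableEq ι] {M : Matrix ι ι ℂ}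
    {y : ι → ℂ} {d : ℂ} (hy : y ≠ 0) (h : y ᵥ* M = d • y) : d ∈ M.charpoly.roots := by
  rw [Polynomial.mem_roots M.charpoly_monic.ne_zero, Polynomial.IsRoot.def, Matrix.eval_charpoly,
    ← Matrix.exists_vecMul_eq_zero_iff]
  refine ⟨y, hy, ?_⟩
  rw [Matrix.vecMul_sub, h, Matrix.scalar_apply, ← Matrix.smul_one_eq_diagonal,
    Matrix.vecMul_smul, Matrix.vecMul_one, sub_self]

/-- The eigenvalues of `B` are real, since conjugate eigenvalues have equal absolute values, and the
left eigenvectors span, so that one of them has a nonzero entry at `o`. -/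
lemma exists_left_eigenvector {n : ℕ} {B : Matrix (Fin n) (Fin n) ℝ} (hd : IsDiagonalizable B)
    (he : EigenvaluesDistinctAbs B) (o : Fin n) :
    ∃ (h : Fin n → ℝ) (c : ℝ), h ᵥ* B = c • h ∧ h o = 1 := by
  obtain ⟨P, d, hP, hB⟩ := hd
  -- the rows of `P⁻¹` are left eigenvectors, and column `o` of `P⁻¹` does not vanish
  obtain ⟨i, hi⟩ : ∃ i, P⁻¹ i o ≠ 0 := by
    by_contra! hc
    have h1 := congrFun (congrFun (Matrix.mul_nonsing_inv P hP) o) o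
    simp [Matrix.mul_apply, hc] at h1
  set y : Fin n → ℂ := fun j => (P⁻¹ i o)⁻¹ * P⁻¹ i j with hy
  have hyo : y o = 1 := inv_mul_cancel₀ hi
  have hyB : y ᵥ* B.map (algebraMap ℝ ℂ) = d i • y := by
    have h1 : P⁻¹ * B.map (algebraMap ℝ ℂ) = Matrix.diagonal d * P⁻¹ := by
      rw [hB, ← Matrix.mul_assoc, ← Matrix.mul_assoc, Matrix.nonsing_inv_mul P hP, Matrix.one_mul]
    ext j
    have h2 := congrFun (congrFun h1 i) j
    rw [Matrix.diagonal_mul, Matrix.mul_apply] at h2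
    simp only [Matrix.vecMul, dotProduct, hy, Pi.smul_apply, smul_eq_mul, mul_assoc,
      ← Finset.mul_sum, h2]
    ring
  have hyj : ∀ j, ∑ k, y k * (B k j : ℂ) = d i * y j := fun j => by
    simpa [Matrix.vecMul, dotProduct] using congrFun hyB j
  -- the conjugate of `d i` is an eigenvalue too, with the same absolute value
  have hreal : (starRingEnd ℂ) (d i) = d i := by
    have hne : y ≠ 0 := fun h => by simp [h] at hyo
    have hne' : (fun j => (starRingEnd ℂ) (y j)) ≠ 0 := fun h => by
      simpa [hyo] using congrFun h o
    refine Multiset.inj_on_of_nodup_map he _ (mem_roots_charpoly_of_vecMul hne' ?_) _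
      (mem_roots_charpoly_of_vecMul hne hyB) (by simp)
    ext j
    simpa [Matrix.vecMul, dotProduct] using congrArg (starRingEnd ℂ) (hyj j)
  obtain ⟨c, hc⟩ := Complex.conj_eq_iff_real.mp hreal
  refine ⟨fun j => (y j).re, c, ?_, by simp [hyo]⟩
  ext j
  have h3 := congrArg Complex.re (hyj j)
  simpa [hc, Matrix.vecMul, dotProduct] using h3

/-- If `hᵀ B = c hᵀ`, then `w hᵀ - A (w hᵀ) B = (w - c A w) hᵀ` for every `w`. -/
lemma vecMulVec_mem_ldrMatrices {n : ℕ} (A : Matrix (Fin n) (Fin n) ℝ)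
    {B : Matrix (Fin n) (Fin n) ℝ} {h : Fin n → ℝ} {c : ℝ} (hB : h ᵥ* B = c • h)
    (w : Fin n → ℝ) : Matrix.vecMulVec w h ∈ ldrMatrices A B := by
  refine ⟨w - c • (A *ᵥ w), h, ?_⟩
  rw [steinDisplacement, Matrix.mul_vecMulVec, Matrix.vecMulVec_mul, hB, Matrix.sub_vecMulVec,
    Matrix.vecMulVec_smul, Matrix.smul_vecMulVec]

/-- Layers without any structure are simulated by LDR layers: each group of `n` units contains one
unit, at position `o`, that has arbitrary weights on the units at position `o` of the preceding
groups and ignores all other units. -/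
lemma exists_layer {n : ℕ} {A B : Matrix (Fin n) (Fin n) ℝ} (hAB : AdmissibleOperators A B)
    (o : Fin n) {k m : ℕ} (w : Fin k → Fin m → ℝ) (c : Fin m → ℝ) (κ : Fin m → UnitKind) :
    ∃ ℓ : Layer A B k m,
      (∀ z j, ℓ.eval z (j, o) = (κ j).act (∑ i, w i j * z (i, o) + c j)) ∧
      ∀ t, ℓ.unitCount t = n * (Finset.univ.filter fun j => κ j = t).card := by
  obtain ⟨h, e, hB, ho⟩ := exists_left_eigenvector hAB.diagonalizable_right hAB.eigenvalues_right o
  -- block `(i, j)` is `(w i j • e_o) hᵀ`; as `h o = 1`, its column `o` is `w i j • e_o`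
  refine ⟨⟨.of fun p q => w p.1 q.1 * Pi.single (M := fun _ => ℝ) o 1 p.2 * h q.2, fun q => c q.1,
    fun q => κ q.1, fun i j => ?_⟩, fun z j => ?_, fun t => ?_⟩
  · exact vecMulVec_mem_ldrMatrices A hB fun r => w i j * Pi.single (M := fun _ => ℝ) o 1 r
  · simp [Layer.eval, Matrix.mulVec, dotProduct, Fintype.sum_prod_type, ho, Pi.single_apply]
  · have : (Finset.univ.filter fun u : Fin m × Fin n => κ u.1 = t) =
        (Finset.univ.filter fun j => κ j = t) ×ˢ Finset.univ := by
      ext; simp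
    simp only [Layer.unitCount, this, Finset.card_product, Finset.card_univ, Fintype.card_fin]
    ring

/-! ### Functions computed by layers -/

/-- `Realizes A B o S l s r`: some sequence of `l` LDR layers, with at most `s` groups of `n` step
units and at most `r` groups of `n` rectifier units, has a last layer whose groups are labelled by
`ι`, and on the padded input `x ∈ [0, 1]` unit `o` of group `i` outputs `S x i`. The other units
of a group are not constrained. -/
def Realizes {n : ℕ} (A B : Matrix (Fin n) (Fin n) ℝ) (o : Fin n) {ι : Type} (S : ℝ → ι → ℝ)
    (l s r : ℕ) : Prop :=
  ∃ (k : ℕ) (e : ι ≃ Fin k) (H : Layers A B 1 k), H.length = l ∧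
    H.unitCount .step ≤ n * s ∧ H.unitCount .relu ≤ n * r ∧
    ∀ x ∈ Set.Icc (0 : ℝ) 1, ∀ i, H.eval (padInput x) (e i, o) = S x i

lemma realizes_input {n : ℕ} {A B : Matrix (Fin n) (Fin n) ℝ} {o : Fin n} (ho : (o : ℕ) = 0)
    {ι : Type} [Unique ι] : Realizes A B o (fun x (_ : ι) => x) 0 0 0 :=
  ⟨1, Equiv.ofUnique _ _, .nil 1, by simp [Layers.length], by simp [Layers.unitCount],
    by simp [Layers.unitCount], fun x _ i => by simp [Layers.eval, padInput, ho]⟩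

/-- One more layer: the new values are units applied to affine functions of the old ones. -/
lemma Realizes.snoc {n : ℕ} {A B : Matrix (Fin n) (Fin n) ℝ} {o : Fin n} {ι ι' : Type}
    [Fintype ι] [Fintype ι'] {S : ℝ → ι → ℝ} {l s r s' r' : ℕ} (hS : Realizes A B o S l s r)
    (hAB : AdmissibleOperators A B) {S' : ℝ → ι' → ℝ} (κ : ι' → UnitKind)
    (h : ∀ j, ∃ (w : ι → ℝ) (c : ℝ), ∀ x ∈ Set.Icc (0 : ℝ) 1,
      S' x j = (κ j).act (∑ i, w i * S x i + c))
    (hs : s + (Finset.univ.filter fun j => κ j = .step).card ≤ s')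
    (hr : r + (Finset.univ.filter fun j => κ j = .relu).card ≤ r') :
    Realizes A B o S' (l + 1) s' r' := by
  obtain ⟨k, e, H, hl, hHs, hHr, hH⟩ := hS
  choose w c hwc using h
  let e' : ι' ≃ Fin (Fintype.card ι') := Fintype.equivFin ι'
  obtain ⟨ℓ, hℓ, hcount⟩ := exists_layer hAB o (fun i j => w (e'.symm j) (e.symm i))
    (fun j => c (e'.symm j)) (fun j => κ (e'.symm j))
  have hcard : ∀ t, (Finset.univ.filter fun j => κ (e'.symm j) = t).card =
      (Finset.univ.filter fun j => κ j = t).card := fun t =>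
    Finset.card_equiv e'.symm (by simp)
  refine ⟨_, e', .snoc H ℓ, by simp [Layers.length, hl], ?_, ?_, fun x hx j => ?_⟩
  · rw [Layers.unitCount, hcount, hcard]
    nlinarith [Nat.mul_le_mul_left n hs]
  · rw [Layers.unitCount, hcount, hcard]
    nlinarith [Nat.mul_le_mul_left n hr]
  · rw [Layers.eval, hℓ, hwc j x hx]
    simp only [Equiv.symm_apply_apply]
    rw [← e.sum_comp]
    simp [hH x hx]

/-- The linear output neuron. -/
lemma Realizes.exists_network {n : ℕ} {A B : Matrix (Fin n) (Fin n) ℝ} {o : Fin n} {ι : Type}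
    [Fintype ι] {S : ℝ → ι → ℝ} {l s r : ℕ} (hS : Realizes A B o S l s r) (a : ι → ℝ) :
    ∃ G : Network A B, G.hidden.length = l ∧ G.hidden.unitCount .step ≤ n * s ∧
      G.hidden.unitCount .relu ≤ n * r ∧
      ∀ x ∈ Set.Icc (0 : ℝ) 1, G.eval x = ∑ i, a i * S x i := by
  obtain ⟨k, e, H, hl, hHs, hHr, hH⟩ := hS
  refine ⟨⟨k, H, fun u => a (e.symm u.1) * Pi.single (M := fun _ => ℝ) o 1 u.2⟩, hl, hHs, hHr,
    fun x hx => ?_⟩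
  simp only [Network.eval, Fintype.sum_prod_type, Pi.single_apply]
  rw [← e.sum_comp]
  simp [hH x hx]

/-! ### Polynomial approximation -/

/-- The approximant is the Taylor polynomial at the midpoint `1 / 2`, all points being within
distance `1 / 2` of the centre. -/
lemma exists_polynomial_approx {f : ℝ → ℝ} {m : ℕ} (hc : ContinuousOn f (Set.Icc 0 1))
    (hd : ∀ k : ℕ, k < m + 1 → DifferentiableOn ℝ (iteratedDeriv k f) (Set.Ioo 0 1))
    (hb : ∀ x ∈ Set.Ioo (0 : ℝ) 1, |iteratedDeriv (m + 1) f x| ≤ ((m + 1).factorial : ℝ)) :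
    ∃ p : Polynomial ℝ, p.natDegree < m + 1 ∧
      ∀ x ∈ Set.Icc (0 : ℝ) 1, |f x - p.eval x| ≤ (1 / 2) ^ (m + 1) := by
  have hsm : ContDiffOn ℝ m f (Set.Ioo 0 1) :=
    contDiffOn_of_differentiableOn_deriv fun k hk =>
      (hd k (Nat.lt_succ_of_le (by exact_mod_cast hk))).congr
        (iteratedDerivWithin_of_isOpen isOpen_Ioo)
  let p : Polynomial ℝ := ∑ k ∈ Finset.range (m + 1),
    Polynomial.C ((k.factorial : ℝ)⁻¹ * iteratedDeriv k f (1 / 2)) *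
      (Polynomial.X - Polynomial.C (1 / 2)) ^ k
  have hp : ∀ x, p.eval x = ∑ k ∈ Finset.range (m + 1),
      (k.factorial : ℝ)⁻¹ * iteratedDeriv k f (1 / 2) * (x - 1 / 2) ^ k := fun x => by
    simp [p, Polynomial.eval_finsetSum]
  have hint : ∀ x ∈ Set.Ioo (0 : ℝ) 1, |f x - p.eval x| ≤ (1 / 2) ^ (m + 1) := by
    intro x hx
    rcases eq_or_ne (1 / 2) x with rfl | hne
    · rw [hp, Finset.sum_range_succ']
      simp
    have hsub : Set.uIcc (1 / 2) x ⊆ Set.Ioo 0 1 :=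
      Set.ordConnected_Ioo.uIcc_subset (by norm_num) hx
    have hu : UniqueDiffOn ℝ (Set.uIcc (1 / 2) x) := uniqueDiffOn_uIcc hne
    have heq : ∀ k, ∀ y ∈ Set.uIoo (1 / 2) x,
        iteratedDerivWithin k f (Set.uIcc (1 / 2) x) y = iteratedDeriv k f y := by
      intro k y hy
      rw [← iteratedDerivWithin_univ, iteratedDerivWithin, iteratedDerivWithin,
        iteratedFDerivWithin_congr_set]
      exact Filter.eventuallyEq_univ.mpr (Icc_mem_nhds_iff.2 hy)
    obtain ⟨y, hy, h⟩ := taylor_mean_remainder_lagrange (n := m) hne (hsm.mono hsub)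
      (((hd m m.lt_succ_self).mono (Set.Ioo_subset_Icc_self.trans hsub)).congr (heq m))
    have hpe : taylorWithinEval f m (Set.uIcc (1 / 2) x) (1 / 2) x = p.eval x := by
      rw [taylor_within_apply, hp]
      refine Finset.sum_congr rfl fun k hk => ?_
      rw [iteratedDerivWithin_eq_iteratedDeriv hu _ Set.left_mem_uIcc, smul_eq_mul]
      · ring
      · refine (hsm.contDiffAt (isOpen_Ioo.mem_nhds (by norm_num))).of_le ?_
        exact_mod_cast Nat.lt_succ_iff.mp (Finset.mem_range.mp hk)
    rw [← hpe, h, heq _ y hy, abs_div, abs_mul, abs_pow, Nat.abs_cast]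
    have hx2 : |x - 1 / 2| ≤ 1 / 2 := abs_le.mpr ⟨by linarith [hx.1], by linarith [hx.2]⟩
    rw [div_le_iff₀ (by positivity), mul_comm]
    exact mul_le_mul (pow_le_pow_left₀ (abs_nonneg _) hx2 _)
      (hb y (hsub (Set.Ioo_subset_Icc_self hy))) (abs_nonneg _) (by positivity)
  refine ⟨p, Nat.lt_succ_of_le ?_, fun x hx => ?_⟩
  · refine Polynomial.natDegree_sum_le_of_forall_le _ _ fun k hk => ?_
    refine (Polynomial.natDegree_C_mul_le _ _).trans ?_
    rw [Polynomial.natDegree_pow, Polynomial.natDegree_X_sub_C, mul_one]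
    exact Nat.lt_succ_iff.mp (Finset.mem_range.mp hk)
  · -- the bound extends to the end points by continuity
    have hcl : closure (Set.Ioo (0 : ℝ) 1) = Set.Icc 0 1 := closure_Ioo zero_ne_one
    refine ContinuousWithinAt.closure_le (s := Set.Ioo 0 1) (f := fun x => |f x - p.eval x|)
      (g := fun _ => (1 / 2) ^ (m + 1)) (hcl ▸ hx) ?_ continuousWithinAt_const hint
    exact (((hc x hx).mono Set.Ioo_subset_Icc_self).sub p.continuous.continuousWithinAt).abs

lemma abs_sub_le_of_abs_deriv_le_one {f : ℝ → ℝ} (hc : ContinuousOn f (Set.Icc 0 1))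
    (hd : DifferentiableOn ℝ f (Set.Ioo 0 1)) (hb : ∀ x ∈ Set.Ioo (0 : ℝ) 1, |deriv f x| ≤ 1)
    {x y : ℝ} (hy : 0 ≤ y) (hyx : y ≤ x) (hx : x ≤ 1) : |f x - f y| ≤ x - y := by
  rcases hyx.eq_or_lt with rfl | hlt
  · simp
  obtain ⟨c, hcm, h⟩ := exists_deriv_eq_slope f hlt (hc.mono (Set.Icc_subset_Icc hy hx))
    (hd.mono (Set.Ioo_subset_Ioo hy hx))
  have h1 := hb c (Set.Ioo_subset_Ioo hy hx hcm)
  rw [h, abs_div, abs_of_pos (sub_pos.mpr hlt), div_le_one (sub_pos.mpr hlt)] at h1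
  exact h1

/-! ### Binary digits -/

/-- The truncation of `x ∈ [0, 1]` to `t` binary digits: the largest multiple of `2 ^ -t` that is
at most `x` and less than `1`. -/
noncomputable def binTrunc (x : ℝ) : ℕ → ℝ
  | 0 => 0
  | t + 1 => binTrunc x t +
      (1 / 2) ^ (t + 1) * UnitKind.step.act (x - binTrunc x t - (1 / 2) ^ (t + 1))

/-- The coefficient of `2 ^ -(t + 1)` in the binary expansion of `x ∈ [0, 1]`, the expansion of `1`
being `0.111…`. It is the output of a step unit. -/
noncomputable def binDigit (x : ℝ) (t : ℕ) : ℝ :=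
  UnitKind.step.act (x - binTrunc x t - (1 / 2) ^ (t + 1))

lemma binDigit_eq_zero_or_one (x : ℝ) (t : ℕ) : binDigit x t = 0 ∨ binDigit x t = 1 := by
  unfold binDigit UnitKind.act
  grind

lemma binTrunc_eq_sum (x : ℝ) (t : ℕ) :
    binTrunc x t = ∑ i : Fin t, (1 / 2) ^ ((i : ℕ) + 1) * binDigit x i := by
  induction t with
  | zero => simp [binTrunc]
  | succ t ih => rw [Fin.sum_univ_castSucc, binTrunc, ← binDigit]; simp [ih]

lemma binTrunc_bounds {x : ℝ} (hx : x ∈ Set.Icc (0 : ℝ) 1) (t : ℕ) :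
    0 ≤ binTrunc x t ∧ binTrunc x t ≤ x ∧ x ≤ binTrunc x t + (1 / 2) ^ t := by
  induction t with
  | zero => simpa [binTrunc] using hx
  | succ t ih =>
    obtain ⟨h1, h2, h3⟩ := ih
    have h4 : (0 : ℝ) < (1 / 2) ^ t := by positivity
    simp only [binTrunc, UnitKind.act, pow_succ]
    split_ifs <;> refine ⟨?_, ?_, ?_⟩ <;> linarith

/-! ### Polynomials of the binary truncation -/

variable {n : ℕ} {A B : Matrix (Fin n) (Fin n) ℝ} {o : Fin n}

lemma act_relu_of_nonneg {t : ℝ} (ht : 0 ≤ t) : UnitKind.relu.act t = t := max_eq_right ht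

/-- A rectifier multiplies a binary digit `d` by a number `c * p` of `[0, 1]`. -/
lemma act_relu_eq_mul {d c p : ℝ} (hd : d = 0 ∨ d = 1) (hc : 0 ≤ c) (hc' : c ≤ 1) (hp : 0 ≤ p)
    (hp' : p ≤ 1) : UnitKind.relu.act (2 * d + c * p - 2) = c * d * p := by
  have h1 : 0 ≤ c * p := mul_nonneg hc hp
  have h2 : c * p ≤ 1 := mul_le_one₀ hc' hp hp'
  rcases hd with rfl | rfl
  · rw [UnitKind.act, max_eq_left] <;> linarith
  · rw [UnitKind.act, max_eq_right] <;> linarith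

/-- Layer by layer, the digits are extracted and stored next to the input. -/
lemma realizes_digits (hAB : AdmissibleOperators A B) (ho : (o : ℕ) = 0) (t : ℕ) :
    Realizes A B o (fun x (i : Option (Fin t)) => i.elim x fun j => binDigit x j)
      t t (t * (t + 1)) := by
  induction t with
  | zero =>
    convert! realizes_input (A := A) (B := B) ho (ι := Option (Fin 0)) using 3 with x i
    rw [Unique.eq_default i]
    rfl
  | succ t ih =>
    refine ih.snoc hAB (fun i => if i = some (Fin.last t) then .step else .relu) ?_ ?_ ?_
    · rintro (_ | j)
      · refine ⟨Pi.single none 1, 0, fun x hx => ?_⟩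
        simp [Pi.single_apply, act_relu_of_nonneg hx.1]
      · induction j using Fin.lastCases with
        | last =>
          refine ⟨fun i => i.elim 1 fun j => -(1 / 2) ^ ((j : ℕ) + 1), -(1 / 2) ^ (t + 1),
            fun x _ => ?_⟩
          simp only [Option.elim, Fin.val_last, if_true, binDigit, Fintype.sum_option]
          rw [binTrunc_eq_sum]
          congr 1
          simp [Finset.sum_neg_distrib, binDigit]
          ring
        | cast j =>
          refine ⟨Pi.single (some j) 1, 0, fun x hx => ?_⟩
          have h0 : 0 ≤ binDigit x j := by
            rcases binDigit_eq_zero_or_one x j with h | h <;> simp [h]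
          have h1 : Fin.castSucc j ≠ Fin.last t := (Fin.castSucc_lt_last j).ne
          simp [Pi.single_apply, act_relu_of_nonneg h0, h1]
    · gcongr
      rw [Finset.card_le_one]
      intro a ha b hb
      simp only [Finset.mem_filter, ite_eq_left_iff, reduceCtorEq] at ha hb
      grind
    · have := Finset.card_filter_le (Finset.univ : Finset (Option (Fin (t + 1))))
        fun i => (if i = some (Fin.last t) then UnitKind.step else .relu) = .relu
      simp only [Finset.card_univ, Fintype.card_option, Fintype.card_fin] at this
      nlinarith

/-- The data kept while the powers of `y = binTrunc x N` are computed: the digits, the first `m`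
powers of `y`, and the summands of `y ^ m = ∑ i, 2 ^ -(i + 1) * binDigit x i * y ^ (m - 1)`. -/
noncomputable def powerState (N m : ℕ) (x : ℝ) : Fin N ⊕ Fin m ⊕ Fin N → ℝ
  | .inl i => binDigit x i
  | .inr (.inl j) => binTrunc x N ^ (j : ℕ)
  | .inr (.inr i) => (1 / 2) ^ ((i : ℕ) + 1) * binDigit x i * binTrunc x N ^ (m - 1)

lemma realizes_powerState (hAB : AdmissibleOperators A B) (ho : (o : ℕ) = 0) (N m : ℕ) :
    Realizes A B o (powerState N (m + 1)) (N + (m + 1)) N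
      (N * (N + 1) + (m + 1) * (2 * N + (m + 1))) := by
  have hd0 : ∀ x (i : ℕ), 0 ≤ binDigit x i := fun x i => by
    rcases binDigit_eq_zero_or_one x i with h | h <;> simp [h]
  induction m with
  | zero =>
    refine (realizes_digits hAB ho N).snoc hAB (fun _ => .relu) ?_ (by simp) ?_
    · rintro (i | j | i)
      · refine ⟨Pi.single (some i) 1, 0, fun x hx => ?_⟩
        simp [powerState, Pi.single_apply, act_relu_of_nonneg (hd0 x i)]
      · refine ⟨0, 1, fun x hx => ?_⟩
        simp [powerState, act_relu_of_nonneg]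
      · refine ⟨Pi.single (some i) ((1 / 2) ^ ((i : ℕ) + 1)), 0, fun x hx => ?_⟩
        have := mul_nonneg (by positivity : (0 : ℝ) ≤ (1 / 2) ^ ((i : ℕ) + 1)) (hd0 x i)
        rw [Fintype.sum_eq_single (some i) (by simp +contextual)]
        simpa [powerState] using (act_relu_of_nonneg this).symm
    · simp; ring_nf; rfl
  | succ m ih =>
    have hsum : ∀ x, ∑ i : Fin N, powerState N (m + 1) x (.inr (.inr i)) =
        binTrunc x N ^ (m + 1) := fun x => by
      simp only [powerState, ← Finset.sum_mul, ← binTrunc_eq_sum, Nat.add_sub_cancel]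
      ring
    refine ih.snoc hAB (fun _ => .relu) ?_ (by simp) ?_
    · rintro (i | j | i)
      · refine ⟨Pi.single (.inl i) 1, 0, fun x hx => ?_⟩
        simp [powerState, Pi.single_apply, act_relu_of_nonneg (hd0 x i)]
      · induction j using Fin.lastCases with
        | last =>
          refine ⟨Sum.elim 0 (Sum.elim 0 1), 0, fun x hx => ?_⟩
          simp only [Fintype.sum_sum_type, Sum.elim_inl, Sum.elim_inr, Pi.zero_apply, zero_mul,
            Finset.sum_const_zero, zero_add, add_zero, Pi.one_apply, one_mul, hsum]
          rw [act_relu_of_nonneg (pow_nonneg (binTrunc_bounds hx N).1 _)]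
          simp [powerState]
        | cast j =>
          refine ⟨Pi.single (.inr (.inl j)) 1, 0, fun x hx => ?_⟩
          have := pow_nonneg (binTrunc_bounds hx N).1 (j : ℕ)
          simp [powerState, Pi.single_apply, act_relu_of_nonneg this]
      · refine ⟨Sum.elim (Pi.single i 2) (Sum.elim 0 fun _ => (1 / 2) ^ ((i : ℕ) + 1)), -2,
          fun x hx => ?_⟩
        obtain ⟨h1, h2, -⟩ := binTrunc_bounds hx N
        simp only [Fintype.sum_sum_type, Sum.elim_inl, Sum.elim_inr, Pi.zero_apply, zero_mul,
          Finset.sum_const_zero, zero_add, ← Finset.mul_sum, hsum]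
        rw [Fintype.sum_eq_single i (by simp +contextual), Pi.single_eq_same,
          ← sub_eq_add_neg]
        refine (act_relu_eq_mul (binDigit_eq_zero_or_one x i) (by positivity)
          (pow_le_one₀ (by norm_num) (by norm_num)) (pow_nonneg h1 _)
          (pow_le_one₀ h1 (h2.trans hx.2))).symm
    · simp
      nlinarith

/-- Every polynomial of degree less than `N` is computed exactly at the binary truncation of the
input. -/
lemma exists_network_eval_binTrunc (hAB : AdmissibleOperators A B) (ho : (o : ℕ) = 0) {N : ℕ}
    {p : Polynomial ℝ} (hp : p.natDegree < N) :
    ∃ G : Network A B, G.hidden.length = 2 * N ∧ G.hidden.unitCount .step ≤ n * N ∧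
      G.hidden.unitCount .relu ≤ n * (N * (4 * N + 1)) ∧
      ∀ x ∈ Set.Icc (0 : ℝ) 1, G.eval x = p.eval (binTrunc x N) := by
  obtain ⟨m, rfl⟩ := Nat.exists_eq_succ_of_ne_zero (Nat.ne_zero_of_lt hp)
  obtain ⟨G, h1, h2, h3, h4⟩ := (realizes_powerState hAB ho (m + 1) m).exists_network
    (Sum.elim 0 (Sum.elim (fun j => p.coeff j) 0))
  refine ⟨G, by omega, h2, h3.trans (Nat.mul_le_mul_left _ (by nlinarith)), fun x hx => ?_⟩
  rw [h4 x hx, Polynomial.eval_eq_sum_range' hp, Finset.sum_range]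
  simp [powerState]

end LDR

theorem mainTheorem4 (b : ℝ) (hb : 1 < b) (hb' : b ≤ Real.exp 1)
    (ε₀ : ℝ) (hε₀ : 0 < ε₀) (hε₀' : ε₀ < 1) :
    ∃ C : ℝ, 0 < C ∧
      ∀ (ε : ℝ), 0 < ε → ε ≤ ε₀ →
      ∀ (n : ℕ), n = ⌈Real.logb b (1 / ε) + 1⌉₊ →
      ∀ (f : ℝ → ℝ), ContinuousOn f (Set.Icc 0 1) →
        (∀ k : ℕ, k < 2 * n + 1 → DifferentiableOn ℝ (iteratedDeriv k f) (Set.Ioo 0 1)) →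
        (∀ k : ℕ, 1 ≤ k → k ≤ 2 * n + 1 → ∀ x ∈ Set.Ioo (0 : ℝ) 1,
          |iteratedDeriv k f x| ≤ (k.factorial : ℝ)) →
      ∀ (A B : Matrix (Fin n) (Fin n) ℝ), LDR.AdmissibleOperators A B →
        ∃ G : LDR.Network A B,
          (G.hidden.length : ℝ) ≤ C * Real.logb b (1 / ε) ∧
          (G.hidden.unitCount LDR.UnitKind.step : ℝ) ≤ C * (n * Real.logb b (1 / ε)) ∧
          (G.hidden.unitCount LDR.UnitKind.relu : ℝ) ≤ C * (n * Real.logb b (1 / ε) ^ 2) ∧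
          ∃ δ : ℝ, δ < ε ∧ ∀ x ∈ Set.Icc (0 : ℝ) 1, |f x - G.eval x| ≤ δ := by
  set L₀ := Real.logb b (1 / ε₀) with hL₀
  have hL₀pos : 0 < L₀ := Real.logb_pos hb ((one_lt_div hε₀).mpr hε₀')
  -- `κ` is chosen so that `n ≤ log (1 / ε) + 2 ≤ κ * log (1 / ε)`
  set κ := 1 + 2 / L₀ with hκ
  have hκ1 : 1 ≤ κ := le_add_of_nonneg_right (by positivity)
  refine ⟨39 * κ ^ 2, by positivity, fun ε hε hεε₀ n hn f hc hd hf A B hAB => ?_⟩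
  set L := Real.logb b (1 / ε) with hL
  have hLL₀ : L₀ ≤ L := Real.logb_le_logb_of_le hb (by positivity)
    (one_div_le_one_div_of_le hε hεε₀)
  have hLpos : 0 < L := hL₀pos.trans_le hLL₀
  have hn1 : L + 1 ≤ n := hn ▸ Nat.le_ceil _
  have hnκ : (n : ℝ) ≤ κ * L := by
    have h1 : (n : ℝ) < L + 1 + 1 := hn ▸ Nat.ceil_lt_add_one (by positivity)
    have h2 : 2 ≤ 2 / L₀ * L := by
      rw [div_mul_eq_mul_div, le_div_iff₀ hL₀pos]
      linarith
    rw [hκ]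
    linarith
  have hnpos : 0 < n := by
    have : (0 : ℝ) < n := by linarith
    exact_mod_cast this
  have hn1' : (1 : ℝ) ≤ n := by exact_mod_cast hnpos
  obtain ⟨p, hp, hfp⟩ := LDR.exists_polynomial_approx (m := 2 * n) hc hd
    (hf (2 * n + 1) (by omega) le_rfl)
  obtain ⟨G, hG1, hG2, hG3, hG4⟩ :=
    LDR.exists_network_eval_binTrunc hAB (o := ⟨0, hnpos⟩) rfl hp
  have hκL : κ * L ≤ κ ^ 2 * L := by
    rw [pow_two]
    exact mul_le_mul_of_nonneg_right (le_mul_of_one_le_left (by linarith) hκ1) hLpos.le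
  refine ⟨G, ?_, ?_, ?_, 2 * (1 / 2) ^ (2 * n + 1), ?_, fun x hx => ?_⟩
  · rw [hG1]
    push_cast
    linarith
  · have h1 : (G.hidden.unitCount .step : ℝ) ≤ n * (2 * n + 1) := by exact_mod_cast hG2
    have h2 : (n : ℝ) * (2 * n + 1) ≤ n * (39 * (κ ^ 2 * L)) :=
      mul_le_mul_of_nonneg_left (by linarith) (by linarith)
    linarith
  · have h1 : (G.hidden.unitCount .relu : ℝ) ≤ n * ((2 * n + 1) * (4 * (2 * n + 1) + 1)) := by
      exact_mod_cast hG3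
    have h2 : (n : ℝ) * ((2 * n + 1) * (4 * (2 * n + 1) + 1)) ≤ n * (39 * (κ * L) ^ 2) :=
      mul_le_mul_of_nonneg_left (by nlinarith) (by linarith)
    linarith
  · -- `2 * 2 ^ -(2 n + 1) = 4 ^ -n ≤ b ^ -n ≤ ε / b`, as `b ≤ e < 4`
    have hb4 : b ≤ 4 := by linarith [Real.exp_one_lt_d9]
    have h1 : (1 / ε) < b ^ n := by
      rw [← Real.rpow_natCast]
      exact (Real.logb_lt_iff_lt_rpow hb (by positivity)).mp (by linarith)
    have h2 : (1 / ε) < 4 ^ n := h1.trans_le (pow_le_pow_left₀ (by linarith) hb4 n)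
    have h3 : (2 : ℝ) * (1 / 2) ^ (2 * n + 1) = 1 / 4 ^ n := by
      rw [pow_succ, pow_mul, show ((1 : ℝ) / 2) ^ 2 = 1 / 4 by norm_num, _root_.one_div_pow]
      ring
    rw [h3]
    exact (one_div_lt hε (by positivity)).mp h2
  · obtain ⟨h1, h2, h3⟩ := LDR.binTrunc_bounds hx (2 * n + 1)
    have h4 := LDR.abs_sub_le_of_abs_deriv_le_one hc
      (by simpa using hd 0 (by omega)) (by simpa using hf 1 le_rfl (by omega)) h1 h2 hx.2
    have h5 := hfp _ ⟨h1, h2.trans hx.2⟩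
    rw [hG4 x hx]
    refine (abs_sub_le _ (f (LDR.binTrunc x (2 * n + 1))) _).trans ?_
    linarith
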